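/- Let $k,\sigma,\delta,L>0$ and $\alpha=ik$. For $N\ge 2$ and $a_1\in\mathbb R$ put $a_j=a_1+(j-1)L$, $b_j=a_j+L+2\delta$ and $\Omega_j=(a_j,b_j)$ for $1\le j\le N$. Write $\mathcal L u=-u''+(ik\sigma-k^2)u$, $\mathcal B_l u=-u'+\alpha u$, $\mathcal B_r u=u'+\alpha u$. Let $u$ be a classical solution ($C^2$ up to the boundary) of $$\mathcal L u=0\ \text{ in }(a_1,b_N),\qquad \mathcal B_l u(a_1)=g_1,\qquad \mathcal B_r u(b_N)=g_2 ,$$ and let $(u_j^n)_{n\ge 0,\,1\le j\le N}$ be iterates of the parallel Schwarz method: the $u_j^0$ are arbitrary $C^1$ functions on $\overline{\Omega_j}$, and for $n\ge 1$ the function $u_j^n$ is a classical solution of $\mathcal L u_j^n=0$ in $\Omega_j$ with $\mathcal B_l u_j^n(a_j)=\mathcal B_l u_{j-1}^{n-1}(a_j)$ if $j\ge 2$, $\mathcal B_r u_j^n(b_j)=\mathcal B_r u_{j+1}^{n-1}(b_j)$ if $j\le N-1$, $\mathcal B_l u_1^n(a_1)=g_1$ and $\mathcal B_r u_N^n(b_N)=g_2$.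 Put $e_j^n=u|_{\Omega_j}-u_j^n$ and $$\mathcal R^n=\big[\mathcal R^n_+(b_1),\mathcal R^n_-(a_2),\mathcal R^n_+(b_2),\mathcal R^n_-(a_3),\dots,\mathcal R^n_+(b_{N-1}),\mathcal R^n_-(a_N)\big]^T\in\mathbb C^{2(N-1)},$$ where $\mathcal R^n_+(b_j)=\mathcal B_r e^n_{j+1}(b_j)$ and $\mathcal R^n_-(a_{j+1})=\mathcal B_l e^n_j(a_{j+1})$ for $1\le j\le N-1$. Let $\zeta=\sqrt{ik\sigma-k^2}$ (principal branch), $D=(\zeta+\alpha)^2e^{\zeta(2\delta+L)}-(\zeta-\alpha)^2e^{-\zeta(2\delta+L)}$, $$a=\frac{(\zeta+\alpha)^2e^{2\zeta\delta}-(\zeta-\alpha)^2e^{-2\zeta\delta}}{D},\qquad b=-\frac{(\zeta^2-\alpha^2)(e^{\zeta L}-e^{-\zeta L})}{D},$$ and let $\mathcal T_{1d}=\mathcal T_{1d}(N)$ be the $(N-1)\times(N-1)$ block tridiagonal block Toeplitz matrix with $2\times 2$ blocks $A_0=\begin{bmatrix}0&b\\ b&0\end{bmatrix}$ on, $A_1=\begin{bmatrix}a&0\\0&0\end{bmatrix}$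 above and $A_{-1}=\begin{bmatrix}0&0\\0&a\end{bmatrix}$ below the block diagonal. Then the following hold. 1. For every $N\ge2$, $\mathcal T_{1d}$ is the interface iteration matrix of the method, i.e. the unique matrix $M$ such that $\mathcal R^{n+1}=M\mathcal R^{n}$ for all $n\ge 0$, for all $a_1\in\mathbb R$, all $g_1,g_2\in\mathbb C$, all solutions $u$ and all iterates $(u_j^n)$ as above. 2. The limit $R_{1d}=\lim_{N\to\infty}\rho(\mathcal T_{1d})$ of the spectral radii exists, and $R_{1d}<1$. 3. The convergence is ultimately independent of the number of subdomains: there are $q\in[0,1)$, $C\in\mathbb R$ and $N_0\in\mathbb N$, depending only on $k,\sigma,\delta,L$, such that for all $N\ge \max(N_0,2)$, all $a_1,g_1,g_2,u$, all iterates $(u_j^n)$ as above and all $n\ge0$, in the Euclidean norm, $\|\mathcal R^n\|_2\le C\,q^n\,\|\mathcal R^0\|_2$. -/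

import Mathlib

open Filter Topology Set
open scoped Matrix ENNReal

noncomputable section

namespace Schwarz1D

/-! ### The Helmholtz problem on an interval -/

/-- The coefficient `i k σ - k²` of the zeroth-order term of the absorptive operator
`u ↦ -u'' + (i k σ - k²) u`. -/
def coeff (k σ : ℝ) : ℂ := Complex.I * k * σ - (k : ℂ) ^ 2

/-- `u` is a classical solution, twice continuously differentiable up to the end points, of
`-u'' + (i k σ - k²) u = 0` on `(a, b)`. -/
def SolvesHelmholtz (k σ a b : ℝ) (u : ℝ → ℂ) : Prop :=
  ContDiffOn ℝ 2 u (Icc a b) ∧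
    ∀ x ∈ Ioo a b, -deriv (deriv u) x + coeff k σ * u x = 0

/-- The left Robin operator `u ↦ -u' + α u` for functions on `[a, b]`, evaluated at `x ∈ [a, b]`
(the derivative is one-sided at the end points). -/
def robinLeft (α : ℂ) (a b : ℝ) (u : ℝ → ℂ) (x : ℝ) : ℂ :=
  -derivWithin u (Icc a b) x + α * u x

/-- The right Robin operator `u ↦ u' + α u` for functions on `[a, b]`, evaluated at `x ∈ [a, b]`
(the derivative is one-sided at the end points). -/
def robinRight (α : ℂ) (a b : ℝ) (u : ℝ → ℂ) (x : ℝ) : ℂ :=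
  derivWithin u (Icc a b) x + α * u x

/-! ### The overlapping decomposition; the subdomains are numbered `1, …, N` -/

/-- The left end point `a_j = a₁ + (j - 1) L` of the `j`-th subdomain. -/
def leftEnd (L a₁ : ℝ) (j : ℕ) : ℝ := a₁ + ((j : ℝ) - 1) * L

/-- The right end point `b_j = a_j + L + 2 δ` of the `j`-th subdomain. -/
def rightEnd (δ L a₁ : ℝ) (j : ℕ) : ℝ := leftEnd L a₁ j + (L + 2 * δ)

/-- The left Robin operator for functions on the closure of the `j`-th subdomain. -/
def subLeft (α : ℂ) (δ L a₁ : ℝ) (j : ℕ) (u : ℝ → ℂ) (x : ℝ) : ℂ :=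
  robinLeft α (leftEnd L a₁ j) (rightEnd δ L a₁ j) u x

/-- The right Robin operator for functions on the closure of the `j`-th subdomain. -/
def subRight (α : ℂ) (δ L a₁ : ℝ) (j : ℕ) (u : ℝ → ℂ) (x : ℝ) : ℂ :=
  robinRight α (leftEnd L a₁ j) (rightEnd δ L a₁ j) u x

/-- `u` solves the global boundary value problem on `(a_1, b_N)` with boundary data `g₁`, `g₂`. -/
structure IsGlobalSolution (α : ℂ) (k σ δ L a₁ : ℝ) (N : ℕ) (g₁ g₂ : ℂ) (u : ℝ → ℂ) : Prop where
  eqn : SolvesHelmholtz k σ (leftEnd L a₁ 1) (rightEnd δ L a₁ N) u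
  left : robinLeft α (leftEnd L a₁ 1) (rightEnd δ L a₁ N) u (leftEnd L a₁ 1) = g₁
  right : robinRight α (leftEnd L a₁ 1) (rightEnd δ L a₁ N) u (rightEnd δ L a₁ N) = g₂

/-- `v n j` (for `1 ≤ j ≤ N`) are the iterates of the parallel Schwarz method, where `n` counts
the iterations and `j` the subdomains; the initial guesses `v 0 j` are arbitrary `C¹` functions. -/
structure IsSchwarzIteration (α : ℂ) (k σ δ L a₁ : ℝ) (N : ℕ) (g₁ g₂ : ℂ)
    (v : ℕ → ℕ → ℝ → ℂ) : Prop where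
  init : ∀ j, 1 ≤ j → j ≤ N → ContDiffOn ℝ 1 (v 0 j) (Icc (leftEnd L a₁ j) (rightEnd δ L a₁ j))
  eqn : ∀ n j, 1 ≤ j → j ≤ N →
    SolvesHelmholtz k σ (leftEnd L a₁ j) (rightEnd δ L a₁ j) (v (n + 1) j)
  /-- Transmission from subdomain `j` to subdomain `j + 1`, at `x = a_{j+1}`. -/
  transLeft : ∀ n j, 1 ≤ j → j + 1 ≤ N →
    subLeft α δ L a₁ (j + 1) (v (n + 1) (j + 1)) (leftEnd L a₁ (j + 1)) =
      subLeft α δ L a₁ j (v n j) (leftEnd L a₁ (j + 1))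
  /-- Transmission from subdomain `j + 1` to subdomain `j`, at `x = b_j`. -/
  transRight : ∀ n j, 1 ≤ j → j + 1 ≤ N →
    subRight α δ L a₁ j (v (n + 1) j) (rightEnd δ L a₁ j) =
      subRight α δ L a₁ (j + 1) (v n (j + 1)) (rightEnd δ L a₁ j)
  bdryLeft : ∀ n, subLeft α δ L a₁ 1 (v (n + 1) 1) (leftEnd L a₁ 1) = g₁
  bdryRight : ∀ n, subRight α δ L a₁ N (v (n + 1) N) (rightEnd δ L a₁ N) = g₂

/-- The Robin interface data of the local errors `e_j = u - w_j` of one iterate `w`: the vector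
`[R₊(b_1), R₋(a_2), R₊(b_2), R₋(a_3), …, R₊(b_{N-1}), R₋(a_N)]`, grouped into `N - 1` pairs
`(R₊(b_j), R₋(a_{j+1}))` with `j = i + 1`, where `R₊(b_j) = (∂ₓ + α) e_{j+1} (b_j)` and
`R₋(a_{j+1}) = (-∂ₓ + α) e_j (a_{j+1})`. -/
def interfaceData (α : ℂ) (δ L a₁ : ℝ) (N : ℕ) (u : ℝ → ℂ) (w : ℕ → ℝ → ℂ) :
    Fin (N - 1) × Fin 2 → ℂ := fun p =>
  let j : ℕ := (p.1 : ℕ) + 1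
  ![subRight α δ L a₁ (j + 1) (fun x => u x - w (j + 1) x) (rightEnd δ L a₁ j),
    subLeft α δ L a₁ j (fun x => u x - w j x) (leftEnd L a₁ (j + 1))] p.2

/-- `M` is an iteration matrix of the interface iteration: whatever the position of the domain,
the boundary data and the initial guesses, it maps the interface data of the errors at each step
of the parallel Schwarz method to those at the next step. -/
def IsIterationMatrix (α : ℂ) (k σ δ L : ℝ) (N : ℕ)
    (M : Matrix (Fin (N - 1) × Fin 2) (Fin (N - 1) × Fin 2) ℂ) : Prop :=
  ∀ (a₁ : ℝ) (g₁ g₂ : ℂ) (u : ℝ → ℂ) (v : ℕ → ℕ → ℝ → ℂ),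
    IsGlobalSolution α k σ δ L a₁ N g₁ g₂ u → IsSchwarzIteration α k σ δ L a₁ N g₁ g₂ v →
    ∀ n, interfaceData α δ L a₁ N u (v (n + 1)) = M *ᵥ interfaceData α δ L a₁ N u (v n)

/-! ### The explicit block Toeplitz matrix -/

/-- `ζ = √(i k σ - k²)`, principal branch. -/
def zeta (k σ : ℝ) : ℂ := coeff k σ ^ (1 / 2 : ℂ)

/-- `D = (ζ + α)² e^{ζ (2 δ + L)} - (ζ - α)² e^{-ζ (2 δ + L)}`. -/
def denom (α : ℂ) (k σ δ L : ℝ) : ℂ :=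
  (zeta k σ + α) ^ 2 * Complex.exp (zeta k σ * (2 * δ + L)) -
    (zeta k σ - α) ^ 2 * Complex.exp (-(zeta k σ * (2 * δ + L)))

/-- `a = ((ζ + α)² e^{2 ζ δ} - (ζ - α)² e^{-2 ζ δ}) / D`. -/
def entryA (α : ℂ) (k σ δ L : ℝ) : ℂ :=
  ((zeta k σ + α) ^ 2 * Complex.exp (2 * zeta k σ * δ) -
    (zeta k σ - α) ^ 2 * Complex.exp (-(2 * zeta k σ * δ))) / denom α k σ δ L

/-- `b = -(ζ² - α²) (e^{ζ L} - e^{-ζ L}) / D`. -/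
def entryB (α : ℂ) (k σ δ L : ℝ) : ℂ :=
  -((zeta k σ ^ 2 - α ^ 2) * (Complex.exp (zeta k σ * L) - Complex.exp (-(zeta k σ * L)))) /
    denom α k σ δ L

/-- The `m × m` block tridiagonal block Toeplitz matrix with `2 × 2` blocks
`A₀ = [0 b; b 0]` on, `A₁ = [a 0; 0 0]` above and `A₋₁ = [0 0; 0 a]` below the diagonal. -/
def blockToeplitz (a b : ℂ) (m : ℕ) : Matrix (Fin m × Fin 2) (Fin m × Fin 2) ℂ :=
  Matrix.of fun p q =>
    if (q.1 : ℕ) = (p.1 : ℕ) then !![0, b; b, 0] p.2 q.2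
    else if (q.1 : ℕ) = (p.1 : ℕ) + 1 then !![a, 0; 0, 0] p.2 q.2
    else if (q.1 : ℕ) + 1 = (p.1 : ℕ) then !![0, 0; 0, a] p.2 q.2
    else 0

/-- The interface iteration matrix for `N` subdomains. -/
def iterationMatrix (α : ℂ) (k σ δ L : ℝ) (N : ℕ) :
    Matrix (Fin (N - 1) × Fin 2) (Fin (N - 1) × Fin 2) ℂ :=
  blockToeplitz (entryA α k σ δ L) (entryB α k σ δ L) (N - 1)

end Schwarz1D

end

/-!
# Scalability of the one-dimensional Schwarz method for the absorptive Helmholtz equation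

**The iteration matrix.** Up to the end points of a subdomain, a solution is a combination of
`e^{ζ x}` and `e^{-ζ x}`, so the two Robin traces which the subdomain transmits are fixed linear
combinations of the two which it receives, with the coefficients `a` and `b`
(`SolvesHelmholtz.traces`). The matrix is unique because every vector occurs as interface data:
choose the initial guesses as combinations of `e^{α x}` and `e^{-α x}`, and solve the subdomain
problems (`exists_isSchwarzIteration`).

**The norm bound.** If the unknowns are paired as `(R₊(b_j), R₋(a_j))`, which are the traces received
by subdomain `j`, the matrix acts on each pair by `[a b; b a]` and then sends the two results to
different blocks. Hence its Euclidean operator norm is at most `r = max(|a + b|, |a - b|)`, whatever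
the number of subdomains (`norm_blockToeplitz_mulVec_le`).

**The bound `r < 1`.** One has `a ± b = T(δ - L/2) / T(δ + L/2)`, where `T = u' + α u` is the right
Robin trace of the even or odd solution `u` (`entryA_add_mul_entryB`). With `α = i k`,
`|T|² = |u'|² + k² |u|² + 2 k Im(u' ū)`. The flux `Im(u' ū)` vanishes at `0` and has the derivative
`k σ |u|²`, and the derivative of `|u'|² + k² |u|²` is `2 k σ` times the flux. By parity `|T(s)| < |T(t)|`
for `|s| < t` (`norm_robinMode_lt`).

**The limit of the spectral radii** is `r`. It is at most `r` by the norm bound. For the converse, let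
`m` be the number of blocks and `η = ±1`. The vectors with the entries `sin (j θ)` and
`η sin ((m + 1 - j) θ)` are eigenvectors for the eigenvalue `a cos θ - b η cos φ` if `φ = (m + 1) θ` and
`b η sin φ = a sin θ` (`mem_spectrum_blockToeplitz`). An inverse function argument gives solutions `φ`
close to `π` for large `m`, and the eigenvalues converge to `a + η b`. No further asymptotic theory of
Toeplitz matrices is needed.
-/

namespace Schwarz1D

/-! ### The Robin traces of the exponential solutions -/

lemma coeff_re (k σ : ℝ) : (coeff k σ).re = -k ^ 2 := by
  simp [coeff, pow_two]

lemma coeff_im (k σ : ℝ) : (coeff k σ).im = k * σ := by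
  simp [coeff, pow_two]

lemma zeta_sq (k σ : ℝ) : zeta k σ ^ 2 = coeff k σ := by
  simp only [zeta, one_div]
  exact Complex.cpow_ofNat_inv_pow _ 2

lemma zeta_re_mul_im (k σ : ℝ) : 2 * ((zeta k σ).re * (zeta k σ).im) = k * σ := by
  have h := congrArg Complex.im (zeta_sq k σ)
  rw [coeff_im, pow_two, Complex.mul_im] at h
  linarith

lemma zeta_re_ne_zero {k σ : ℝ} (hk : 0 < k) (hσ : 0 < σ) : (zeta k σ).re ≠ 0 := by
  intro h
  have := zeta_re_mul_im k σ
  rw [h] at this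
  nlinarith [mul_pos hk hσ]

lemma zeta_ne_zero {k σ : ℝ} (hk : 0 < k) (hσ : 0 < σ) : zeta k σ ≠ 0 := fun h =>
  zeta_re_ne_zero hk hσ (by simp [h])

/-- The flux `Im (u' ū)` of a solution of `u'' = (i k σ - k²) u` increases at the rate of
absorption `k σ |u|²`. -/
lemma hasDerivAt_flux {k σ : ℝ} {u w : ℝ → ℂ} {t : ℝ} (hu : HasDerivAt u (w t) t)
    (hw : HasDerivAt w (coeff k σ * u t) t) :
    HasDerivAt (fun s => (w s * star (u s)).im) (k * σ * ‖u t‖ ^ 2) t := by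
  have h := Complex.imCLM.hasFDerivAt.comp_hasDerivAt t (hw.mul hu.star)
  refine h.congr_deriv ?_
  rw [Complex.sq_norm, Complex.normSq_apply]
  simp [Complex.mul_im, coeff_re, coeff_im]
  ring

/-- The energy `|u'|² + k² |u|²` of a solution of `u'' = (i k σ - k²) u` grows with the flux. -/
lemma hasDerivAt_energy {k σ : ℝ} {u w : ℝ → ℂ} {t : ℝ} (hu : HasDerivAt u (w t) t)
    (hw : HasDerivAt w (coeff k σ * u t) t) :
    HasDerivAt (fun s => ‖w s‖ ^ 2 + k ^ 2 * ‖u s‖ ^ 2)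
      (2 * (k * σ) * (w t * star (u t)).im) t := by
  refine (hw.norm_sq.add (hu.norm_sq.const_mul (k ^ 2))).congr_deriv ?_
  simp [Complex.inner, Complex.mul_im, Complex.mul_re, coeff_re, coeff_im]
  ring

lemma sq_norm_add_I_mul (k : ℝ) (u w : ℂ) :
    ‖w + Complex.I * k * u‖ ^ 2 = ‖w‖ ^ 2 + k ^ 2 * ‖u‖ ^ 2 + 2 * k * (w * star u).im := by
  simp only [Complex.sq_norm, Complex.normSq_apply]
  simp [Complex.mul_im]
  ring

/-- The even (`ε = 1`) or odd (`ε = -1`) solution of `u'' = ζ² u`. -/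
noncomputable def expMode (ζ ε : ℂ) (t : ℝ) : ℂ := Complex.exp (ζ * t) + ε * Complex.exp (-(ζ * t))

/-- The right Robin trace `u' + α u` of `expMode ζ ε`. -/
noncomputable def robinMode (α ζ ε : ℂ) (t : ℝ) : ℂ :=
  (ζ + α) * Complex.exp (ζ * t) - ε * ((ζ - α) * Complex.exp (-(ζ * t)))

lemma hasDerivAt_exp_mul (ζ : ℂ) (t : ℝ) :
    HasDerivAt (fun s : ℝ => Complex.exp (ζ * s)) (ζ * Complex.exp (ζ * t)) t := by
  have h : HasDerivAt (fun s : ℝ => ζ * (s : ℂ)) ζ t := by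
    simpa using (Complex.ofRealCLM.hasDerivAt (x := t)).const_mul ζ
  simpa [mul_comm] using h.cexp

lemma hasDerivAt_exp_neg_mul (ζ : ℂ) (t : ℝ) :
    HasDerivAt (fun s : ℝ => Complex.exp (-(ζ * s))) (-(ζ * Complex.exp (-(ζ * t)))) t := by
  simpa using hasDerivAt_exp_mul (-ζ) t

lemma hasDerivAt_expMode (ζ ε : ℂ) (t : ℝ) :
    HasDerivAt (expMode ζ ε) (ζ * expMode ζ (-ε) t) t := by
  refine ((hasDerivAt_exp_mul ζ t).add ((hasDerivAt_exp_neg_mul ζ t).const_mul ε)).congr_deriv ?_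
  simp only [expMode]; ring

lemma expMode_neg {ζ ε : ℂ} (hε : ε * ε = 1) (t : ℝ) : expMode ζ ε (-t) = ε * expMode ζ ε t := by
  simp only [expMode, Complex.ofReal_neg, mul_neg, neg_neg]
  linear_combination (-Complex.exp (-(ζ * t))) * hε

lemma robinMode_eq (α ζ ε : ℂ) (t : ℝ) :
    robinMode α ζ ε t = ζ * expMode ζ (-ε) t + α * expMode ζ ε t := by
  simp only [robinMode, expMode]; ring

lemma expMode_ne_zero {ζ ε : ℂ} (hζ : ζ.re ≠ 0) (hε : ‖ε‖ = 1) {t : ℝ} (ht : t ≠ 0) :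
    expMode ζ ε t ≠ 0 := by
  intro h
  have h1 : ‖Complex.exp (ζ * t)‖ = ‖Complex.exp (-(ζ * t))‖ := by
    rw [eq_neg_of_add_eq_zero_left h, norm_neg, norm_mul, hε, one_mul]
  simp only [Complex.norm_exp, Real.exp_eq_exp, Complex.neg_re, Complex.re_mul_ofReal] at h1
  exact mul_ne_zero hζ ht (by linarith)

/-- The flux of a mode is an odd function, and positive to the right of the origin. Together with
the growth of the energy this makes the size of the right Robin trace at `t` dominate that at every
point `s` closer to the origin. -/
lemma norm_robinMode_lt {k σ : ℝ} (hk : 0 < k) (hσ : 0 < σ) {ε : ℂ} (hε : ε = 1 ∨ ε = -1)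
    {s t : ℝ} (hst : |s| < t) :
    ‖robinMode (Complex.I * k) (zeta k σ) ε s‖ < ‖robinMode (Complex.I * k) (zeta k σ) ε t‖ := by
  set ζ := zeta k σ with hζ
  have hεε : ε * ε = 1 := by rcases hε with rfl | rfl <;> norm_num
  have hε1 : ‖ε‖ = 1 := by rcases hε with rfl | rfl <;> simp
  set u := expMode ζ ε with hu
  set w : ℝ → ℂ := fun r => ζ * expMode ζ (-ε) r with hw
  have hdu : ∀ r, HasDerivAt u (w r) r := fun r => hasDerivAt_expMode ζ ε r
  have hdw : ∀ r, HasDerivAt w (coeff k σ * u r) r := fun r => by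
    refine ((hasDerivAt_expMode ζ (-ε) r).const_mul ζ).congr_deriv ?_
    rw [← zeta_sq, neg_neg]; ring
  have hun : ∀ r, u (-r) = ε * u r := expMode_neg hεε
  have hwn : ∀ r, w (-r) = -ε * w r := fun r => by
    simp only [hw]
    rw [expMode_neg (by linear_combination hεε)]; ring
  set F : ℝ → ℝ := fun r => (w r * star (u r)).im with hF
  set G : ℝ → ℝ := fun r => ‖w r‖ ^ 2 + k ^ 2 * ‖u r‖ ^ 2 with hG
  have hdF : ∀ r, HasDerivAt F (k * σ * ‖u r‖ ^ 2) r := fun r => hasDerivAt_flux (hdu r) (hdw r)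
  have hdG : ∀ r, HasDerivAt G (2 * (k * σ) * F r) r := fun r => hasDerivAt_energy (hdu r) (hdw r)
  have hFn : ∀ r, F (-r) = -F r := fun r => by
    simp only [hF, hun, hwn]
    rcases hε with rfl | rfl <;> simp
  have hGn : ∀ r, G (-r) = G r := fun r => by
    simp only [hG, hun, hwn, norm_mul, norm_neg, hε1, one_mul]
  have hF0 : F 0 = 0 := by have := hFn 0; rw [neg_zero] at this; linarith
  have hkσ := mul_pos hk hσ
  have hFm : StrictMonoOn F (Ici 0) := by
    refine strictMonoOn_of_deriv_pos (convex_Ici 0)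
      (fun r _ => (hdF r).continuousAt.continuousWithinAt) fun r hr => ?_
    rw [interior_Ici, mem_Ioi] at hr
    rw [(hdF r).deriv]
    have := norm_pos_iff.2 (expMode_ne_zero (zeta_re_ne_zero hk hσ) hε1 hr.ne')
    positivity
  have hFpos : ∀ r, 0 < r → 0 < F r := fun r hr => hF0 ▸ hFm self_mem_Ici hr.le hr
  have hGm : StrictMonoOn G (Ici 0) := by
    refine strictMonoOn_of_deriv_pos (convex_Ici 0)
      (fun r _ => (hdG r).continuousAt.continuousWithinAt) fun r hr => ?_
    rw [interior_Ici, mem_Ioi] at hr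
    rw [(hdG r).deriv]
    have := hFpos r hr
    positivity
  have ht : 0 < t := (abs_nonneg s).trans_lt hst
  have h1 : G s < G t := by
    have : G s = G |s| := by rcases abs_choice s with h | h <;> rw [h]; rw [hGn]
    rw [this]
    exact hGm (abs_nonneg s) ht.le hst
  have h2 : F s < F t := by
    refine lt_of_le_of_lt ?_ (hFm (abs_nonneg s) ht.le hst)
    rcases le_or_gt 0 s with h | h
    · rw [abs_of_nonneg h]
    · rw [abs_of_neg h, hFn]
      have := hFpos (-s) (by linarith)
      rw [hFn] at this
      linarith
  have key : ∀ r, ‖robinMode (Complex.I * k) ζ ε r‖ ^ 2 = G r + 2 * k * F r := fun r => by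
    rw [robinMode_eq, sq_norm_add_I_mul]
  refine lt_of_pow_lt_pow_left₀ 2 (norm_nonneg _) ?_
  rw [key, key]
  nlinarith

/-! ### The entries of the iteration matrix -/

lemma denom_eq (α : ℂ) (k σ δ L : ℝ) :
    denom α k σ δ L = robinMode α (zeta k σ) 1 (δ + L / 2) *
      robinMode α (zeta k σ) (-1) (δ + L / 2) := by
  set z := zeta k σ * ((δ + L / 2 : ℝ) : ℂ) with hz
  have h : zeta k σ * (2 * δ + L) = z + z := by rw [hz]; push_cast; ring
  simp only [denom, robinMode]
  rw [h, neg_add, Complex.exp_add, Complex.exp_add, ← hz]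
  ring

lemma robinMode_ne_zero {k σ : ℝ} (hk : 0 < k) (hσ : 0 < σ) {ε : ℂ} (hε : ε = 1 ∨ ε = -1)
    {t : ℝ} (ht : 0 < t) : robinMode (Complex.I * k) (zeta k σ) ε t ≠ 0 :=
  norm_pos_iff.1 ((norm_nonneg _).trans_lt
    (norm_robinMode_lt hk hσ hε (s := 0) (by rwa [abs_zero])))

lemma denom_ne_zero {k σ δ L : ℝ} (hk : 0 < k) (hσ : 0 < σ) (hδ : 0 < δ) (hL : 0 < L) :
    denom (Complex.I * k) k σ δ L ≠ 0 := by
  rw [denom_eq]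
  exact mul_ne_zero (robinMode_ne_zero hk hσ (.inl rfl) (by positivity))
    (robinMode_ne_zero hk hσ (.inr rfl) (by positivity))

lemma entryA_add_mul_entryB {α : ℂ} {k σ δ L : ℝ} (hD : denom α k σ δ L ≠ 0) {ε : ℂ}
    (hε : ε = 1 ∨ ε = -1) :
    entryA α k σ δ L + ε * entryB α k σ δ L =
      robinMode α (zeta k σ) ε (δ - L / 2) / robinMode α (zeta k σ) ε (δ + L / 2) := by
  have hne : robinMode α (zeta k σ) ε (δ + L / 2) ≠ 0 := by
    rw [denom_eq] at hD
    rcases hε with rfl | rfl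
    exacts [left_ne_zero_of_mul hD, right_ne_zero_of_mul hD]
  have hεε : ε * ε = 1 := by rcases hε with rfl | rfl <;> norm_num
  rw [eq_div_iff hne, entryA, entryB, mul_div_assoc', ← add_div, div_mul_eq_mul_div,
    div_eq_iff hD]
  have hD' : denom α k σ δ L = robinMode α (zeta k σ) ε (δ + L / 2) *
      robinMode α (zeta k σ) (-ε) (δ + L / 2) := by
    rw [denom_eq]
    rcases hε with rfl | rfl
    · rfl
    · rw [neg_neg, mul_comm]
  rw [hD', mul_left_comm]
  rw [mul_comm]
  congr 1
  simp only [robinMode]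
  set p := zeta k σ * ((δ + L / 2 : ℝ) : ℂ) with hp
  set m := zeta k σ * ((δ - L / 2 : ℝ) : ℂ) with hm
  have h1 : 2 * zeta k σ * δ = p + m := by rw [hp, hm]; push_cast; ring
  have h2 : zeta k σ * L = p + -m := by rw [hp, hm]; push_cast; ring
  have h3 : -(p + -m) = -p + m := by ring
  rw [h1, h2, h3, neg_add]
  simp only [Complex.exp_add]
  linear_combination ((zeta k σ - α) ^ 2 * Complex.exp (-p) * Complex.exp (-m)) * hεε

lemma norm_entryA_add_mul_entryB_lt_one {k σ δ L : ℝ} (hk : 0 < k) (hσ : 0 < σ) (hδ : 0 < δ)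
    (hL : 0 < L) {ε : ℂ} (hε : ε = 1 ∨ ε = -1) :
    ‖entryA (Complex.I * k) k σ δ L + ε * entryB (Complex.I * k) k σ δ L‖ < 1 := by
  rw [entryA_add_mul_entryB (denom_ne_zero hk hσ hδ hL) hε, norm_div,
    div_lt_one (norm_pos_iff.2 (robinMode_ne_zero hk hσ hε (by positivity)))]
  exact norm_robinMode_lt hk hσ hε (abs_lt.2 ⟨by linarith, by linarith⟩)

lemma entryB_ne_zero {k σ δ L : ℝ} (hk : 0 < k) (hσ : 0 < σ) (hδ : 0 < δ) (hL : 0 < L) :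
    entryB (Complex.I * k) k σ δ L ≠ 0 := by
  refine div_ne_zero (neg_ne_zero.2 (mul_ne_zero ?_ ?_)) (denom_ne_zero hk hσ hδ hL)
  · have h : zeta k σ ^ 2 - (Complex.I * k) ^ 2 = Complex.I * k * σ := by
      rw [zeta_sq, coeff, mul_pow, Complex.I_sq]; ring
    rw [h]
    simp [hk.ne', hσ.ne']
  · have := expMode_ne_zero (zeta_re_ne_zero hk hσ) (ε := -1) (by simp) hL.ne'
    rwa [expMode, neg_one_mul, ← sub_eq_add_neg] at this

/-! ### The action and the norm of the block Toeplitz matrix -/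

/-- The vector with blocks `(p i, q (i + 1))`. The shift in `q` lines up the two unknowns that the
matrix mixes: `blockToeplitz a b m` sends the pair `(p i, q i)` to `(a p i + b q i, b p i + a q i)`,
placed in blocks `i - 1` and `i`. -/
def pack (m : ℕ) (p q : ℕ → ℂ) : Fin m × Fin 2 → ℂ := fun x => ![p x.1, q (x.1 + 1)] x.2

lemma exists_eq_pack {m : ℕ} (v : Fin m × Fin 2 → ℂ) :
    ∃ p q : ℕ → ℂ, p m = 0 ∧ q 0 = 0 ∧ v = pack m p q := by
  refine ⟨fun i => if h : i < m then v (⟨i, h⟩, 0) else 0,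
    fun i => if h : 0 < i ∧ i - 1 < m then v (⟨i - 1, h.2⟩, 1) else 0, by simp, by simp, ?_⟩
  ext ⟨i, c⟩
  fin_cases c <;> simp [pack]

lemma blockToeplitz_mulVec_pack (a b : ℂ) {m : ℕ} {p q : ℕ → ℂ} (hp : p m = 0) (hq : q 0 = 0) :
    blockToeplitz a b m *ᵥ pack m p q =
      pack m (fun i => a * p (i + 1) + b * q (i + 1))
        (fun i => b * p (i - 1) + a * q (i - 1)) := by
  ext ⟨i, c⟩
  obtain ⟨i, hi⟩ := i
  simp only [Matrix.mulVec, dotProduct, Fintype.sum_prod_type, Fin.sum_univ_two, pack,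
    blockToeplitz, Matrix.of_apply]
  fin_cases c
  · trans ∑ j : Fin m, ((if (j : ℕ) = i + 1 then a * p j else 0) +
      (if (j : ℕ) = i then b * q (j + 1) else 0))
    · refine Finset.sum_congr rfl fun j _ => ?_
      split_ifs <;> first | omega | simp
    rw [Fin.sum_univ_eq_sum_range (fun j => (if j = i + 1 then a * p j else 0) +
      (if j = i then b * q (j + 1) else 0)), Finset.sum_add_distrib, Finset.sum_ite_eq',
      Finset.sum_ite_eq', if_pos (Finset.mem_range.2 hi)]
    change _ = a * p (i + 1) + b * q (i + 1)
    split_ifs with h1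
    · rfl
    · have : i + 1 = m := by rw [Finset.mem_range] at h1; omega
      rw [this, hp, mul_zero]
  · trans ∑ j : Fin m, ((if (j : ℕ) = i then b * p j else 0) +
      (if (j : ℕ) + 1 = i then a * q (j + 1) else 0))
    · refine Finset.sum_congr rfl fun j _ => ?_
      split_ifs <;> first | omega | simp
    rw [Fin.sum_univ_eq_sum_range (fun j => (if j = i then b * p j else 0) +
      (if j + 1 = i then a * q (j + 1) else 0)), Finset.sum_add_distrib, Finset.sum_ite_eq',
      if_pos (Finset.mem_range.2 hi)]
    change _ = b * p i + a * q i
    congr 1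
    rcases i with _ | i
    · simp [hq]
    · simp only [Nat.add_right_cancel_iff]
      rw [Finset.sum_ite_eq', if_pos (Finset.mem_range.2 (by omega))]

lemma norm_sq_pack (m : ℕ) (p q : ℕ → ℂ) :
    ‖WithLp.toLp 2 (pack m p q)‖ ^ 2 = ∑ i ∈ Finset.range m, (‖p i‖ ^ 2 + ‖q (i + 1)‖ ^ 2) := by
  rw [EuclideanSpace.norm_sq_eq, Fintype.sum_prod_type,
    ← Fin.sum_univ_eq_sum_range (fun i => ‖p i‖ ^ 2 + ‖q (i + 1)‖ ^ 2)]
  simp [pack]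

/-- The matrix `[a b; b a]` has the singular values `|a + b|` and `|a - b|`. -/
lemma sq_norm_add_sq_norm_le {a b : ℂ} {r : ℝ} (h₁ : ‖a + b‖ ≤ r) (h₂ : ‖a - b‖ ≤ r) (x y : ℂ) :
    ‖a * x + b * y‖ ^ 2 + ‖b * x + a * y‖ ^ 2 ≤ r ^ 2 * (‖x‖ ^ 2 + ‖y‖ ^ 2) := by
  have e1 := parallelogram_law_with_norm ℝ (a * x + b * y) (b * x + a * y)
  have e2 := parallelogram_law_with_norm ℝ x y
  have e3 : a * x + b * y + (b * x + a * y) = (a + b) * (x + y) := by ring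
  have e4 : a * x + b * y - (b * x + a * y) = (a - b) * (x - y) := by ring
  rw [e3, e4, norm_mul, norm_mul] at e1
  have i1 : ‖a + b‖ ^ 2 ≤ r ^ 2 := by gcongr
  have i2 : ‖a - b‖ ^ 2 ≤ r ^ 2 := by gcongr
  nlinarith [mul_le_mul_of_nonneg_right i1 (sq_nonneg ‖x + y‖),
    mul_le_mul_of_nonneg_right i2 (sq_nonneg ‖x - y‖)]

lemma norm_blockToeplitz_mulVec_le {a b : ℂ} {r : ℝ} (h₁ : ‖a + b‖ ≤ r) (h₂ : ‖a - b‖ ≤ r) {m : ℕ}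
    (v : Fin m × Fin 2 → ℂ) :
    ‖WithLp.toLp 2 (blockToeplitz a b m *ᵥ v)‖ ≤ r * ‖WithLp.toLp 2 v‖ := by
  have hr : 0 ≤ r := (norm_nonneg _).trans h₁
  obtain ⟨p, q, hp, hq, rfl⟩ := exists_eq_pack v
  rw [blockToeplitz_mulVec_pack a b hp hq]
  refine le_of_sq_le_sq ?_ (by positivity)
  rw [mul_pow, norm_sq_pack, norm_sq_pack]
  -- Regrouped by pairs `(p i, q i)`, both sides run over `i ≤ m`; on the left two terms are dropped.
  calc ∑ i ∈ Finset.range m, (‖a * p (i + 1) + b * q (i + 1)‖ ^ 2 +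
          ‖b * p (i + 1 - 1) + a * q (i + 1 - 1)‖ ^ 2)
      ≤ ∑ i ∈ Finset.range (m + 1), (‖a * p i + b * q i‖ ^ 2 + ‖b * p i + a * q i‖ ^ 2) := by
        simp only [Finset.sum_add_distrib, Nat.add_sub_cancel]
        rw [Finset.sum_range_succ' _ m, Finset.sum_range_succ _ m]
        nlinarith [sq_nonneg ‖a * p 0 + b * q 0‖, sq_nonneg ‖b * p m + a * q m‖]
    _ ≤ ∑ i ∈ Finset.range (m + 1), r ^ 2 * (‖p i‖ ^ 2 + ‖q i‖ ^ 2) :=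
        Finset.sum_le_sum fun i _ => sq_norm_add_sq_norm_le h₁ h₂ _ _
    _ = r ^ 2 * ∑ i ∈ Finset.range m, (‖p i‖ ^ 2 + ‖q (i + 1)‖ ^ 2) := by
        rw [← Finset.mul_sum]
        simp only [Finset.sum_add_distrib]
        rw [Finset.sum_range_succ, Finset.sum_range_succ' (fun i => ‖q i‖ ^ 2), hp, hq]
        simp

/-! ### The limit of the spectral radii -/

lemma mem_spectrum_of_mulVec_eq {n : Type*} [Fintype n] [DecidableEq n] {M : Matrix n n ℂ} {μ : ℂ}
    {v : n → ℂ} (hv : v ≠ 0) (h : M *ᵥ v = μ • v) : μ ∈ spectrum ℂ M := by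
  rw [← Matrix.spectrum_toLin', ← Module.End.hasEigenvalue_iff_mem_spectrum]
  exact Module.End.hasEigenvalue_of_hasEigenvector
    (Module.End.hasEigenvector_iff.2 ⟨Module.End.mem_eigenspace_iff.2 (by simpa using h), hv⟩)

lemma exists_mulVec_eq_of_mem_spectrum {n : Type*} [Fintype n] [DecidableEq n] {M : Matrix n n ℂ}
    {μ : ℂ} (h : μ ∈ spectrum ℂ M) : ∃ v : n → ℂ, v ≠ 0 ∧ M *ᵥ v = μ • v := by
  rw [← Matrix.spectrum_toLin', ← Module.End.hasEigenvalue_iff_mem_spectrum] at h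
  obtain ⟨v, hv⟩ := h.exists_hasEigenvector
  exact ⟨v, hv.2, by simpa using hv.apply_eq_smul⟩

lemma spectralRadius_blockToeplitz_le {a b : ℂ} {r : ℝ} (h₁ : ‖a + b‖ ≤ r) (h₂ : ‖a - b‖ ≤ r)
    (m : ℕ) : spectralRadius ℂ (blockToeplitz a b m) ≤ ENNReal.ofReal r := by
  refine iSup₂_le fun μ hμ => ?_
  obtain ⟨v, hv, hμv⟩ := exists_mulVec_eq_of_mem_spectrum hμ
  have h := norm_blockToeplitz_mulVec_le h₁ h₂ v
  rw [hμv, WithLp.toLp_smul, norm_smul] at h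
  have hv' : 0 < ‖WithLp.toLp 2 v‖ := norm_pos_iff.2 (by simpa using hv)
  have h3 := ENNReal.ofReal_le_ofReal (le_of_mul_le_mul_right h hv')
  rwa [ofReal_norm] at h3

/-- The eigenvectors `p i = η sin ((m - i) θ)`, `q i = sin (i θ)`: the symmetry `p i = η q (m - i)`
reduces the two rows of a block to one, and turns the boundary condition into the equation
`b η sin φ = a sin θ` for `φ = (m + 1) θ`, the block indices starting at `0`. -/
lemma mem_spectrum_blockToeplitz {a b η φ θ : ℂ} {m : ℕ} (hm : 0 < m) (hη : η * η = 1)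
    (hφ : φ = m * θ + θ) (hθ : Complex.sin θ ≠ 0)
    (h : b * η * Complex.sin φ = a * Complex.sin θ) :
    a * Complex.cos θ - b * η * Complex.cos φ ∈ spectrum ℂ (blockToeplitz a b m) := by
  set μ := a * Complex.cos θ - b * η * Complex.cos φ with hμ
  have key : ∀ z : ℂ, b * η * Complex.sin (φ - (z + θ)) + a * Complex.sin z =
      μ * Complex.sin (z + θ) := fun z => by
    have hz : Complex.sin z = Complex.sin (z + θ) * Complex.cos θ -
        Complex.cos (z + θ) * Complex.sin θ := by
      rw [← Complex.sin_sub, add_sub_cancel_right]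
    rw [hz, Complex.sin_sub, hμ]
    linear_combination Complex.cos (z + θ) * h
  have hv := blockToeplitz_mulVec_pack a b (m := m)
    (p := fun i => η * Complex.sin ((m - i) * θ)) (q := fun i => Complex.sin (i * θ))
    (by simp) (by simp)
  refine mem_spectrum_of_mulVec_eq (fun h0 => ?_) (hv.trans ?_)
  · exact hθ (by simpa [pack] using congrFun h0 (⟨0, hm⟩, 1))
  · ext ⟨i, c⟩
    fin_cases c
    · have e1 : φ - ((m - (i + 1)) * θ + θ) = (i + 1) * θ := by rw [hφ]; ring
      have e2 : ((m : ℂ) - (i + 1)) * θ + θ = (m - i) * θ := by ring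
      have := key ((m - (i + 1)) * θ)
      rw [e1, e2] at this
      simp [pack]
      linear_combination η * this - b * Complex.sin ((i + 1) * θ) * hη
    · have e1 : φ - (i * θ + θ) = (m - i) * θ := by rw [hφ]; ring
      have e2 : (i : ℂ) * θ + θ = (i + 1) * θ := by ring
      have := key (i * θ)
      rw [e1, e2] at this
      simp [pack]
      linear_combination this

/-- The equation `sin φ = κ sin (t φ)` can be solved for `φ` close to `π` when `t` is small. -/
lemma eventually_exists_sin_eq (κ : ℂ) {U : Set (ℂ × ℂ)} (hU : U ∈ 𝓝 ((Real.pi : ℂ), (0 : ℂ))) :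
    ∀ᶠ t : ℂ in 𝓝 0, ∃ φ : ℂ, (φ, t) ∈ U ∧ Complex.sin φ = κ * Complex.sin (t * φ) := by
  let f : ℂ × ℂ → ℂ × ℂ := fun x => (Complex.sin x.1 - κ * Complex.sin (x.2 * x.1), x.2)
  have h1 : HasStrictFDerivAt (fun x : ℂ × ℂ => x.1) (.fst ℂ ℂ ℂ) ((Real.pi : ℂ), (0 : ℂ)) :=
    hasStrictFDerivAt_fst
  have h2 : HasStrictFDerivAt (fun x : ℂ × ℂ => x.2) (.snd ℂ ℂ ℂ) ((Real.pi : ℂ), (0 : ℂ)) :=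
    hasStrictFDerivAt_snd
  have hf : HasStrictFDerivAt f _ ((Real.pi : ℂ), (0 : ℂ)) :=
    (h1.csin.sub ((h2.mul h1).csin.const_mul κ)).prodMk h2
  have hmap := hf.map_nhds_eq_of_surj (LinearMap.range_eq_top.2 fun y =>
    ⟨(-(y.1 + κ * Real.pi * y.2), y.2), by
      refine Prod.ext ?_ ?_
      · simp; ring
      · simp⟩)
  have hf0 : f ((Real.pi : ℂ), (0 : ℂ)) = (0, 0) := by simp [f]
  rw [hf0] at hmap
  have h3 : f '' U ∈ 𝓝 ((0 : ℂ), (0 : ℂ)) := hmap ▸ image_mem_map hU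
  have h4 : Tendsto (fun t : ℂ => ((0 : ℂ), t)) (𝓝 0) (𝓝 (0, 0)) :=
    (Continuous.prodMk_right (0 : ℂ)).tendsto 0
  filter_upwards [h4 h3] with t ht
  obtain ⟨⟨φ, s⟩, hx, hxt⟩ := ht
  obtain ⟨e1, rfl⟩ := Prod.ext_iff.1 hxt
  exact ⟨φ, hx, sub_eq_zero.1 e1⟩

/-- Both `a + b` and `a - b` are limits of eigenvalues. -/
lemma eventually_exists_mem_spectrum {a b η : ℂ} (hb : b ≠ 0) (hη : η * η = 1)
    {V : Set ℂ} (hV : V ∈ 𝓝 (a + η * b)) :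
    ∀ᶠ m : ℕ in atTop, ∃ μ ∈ V, μ ∈ spectrum ℂ (blockToeplitz a b m) := by
  let g : ℂ × ℂ → ℂ := fun x =>
    a * Complex.cos (x.2 * x.1) - b * η * Complex.cos x.1
  have hg : Continuous g := by fun_prop
  have hg0 : g ((Real.pi : ℂ), (0 : ℂ)) = a + η * b := by simp [g]; ring
  have h1 : ∀ᶠ x in 𝓝 ((Real.pi : ℂ), (0 : ℂ)), g x ∈ V :=
    hg.continuousAt.tendsto (hg0 ▸ hV)
  have h2 : ∀ᶠ x : ℂ × ℂ in 𝓝 ((Real.pi : ℂ), (0 : ℂ)), x.1 ≠ 0 :=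
    continuousAt_fst.eventually_ne (by simp [Real.pi_ne_zero])
  have h3 : ∀ᶠ x : ℂ × ℂ in 𝓝 ((Real.pi : ℂ), (0 : ℂ)), ‖x.2 * x.1‖ < Real.pi := by
    refine ContinuousAt.eventually_lt (f := fun x : ℂ × ℂ => ‖x.2 * x.1‖) (by fun_prop)
      continuousAt_const ?_
    simpa using Real.pi_pos
  have h4 : Tendsto (fun m : ℕ => ((m : ℂ) + 1)⁻¹) atTop (𝓝 0) := by
    simpa using tendsto_one_div_add_atTop_nhds_zero_nat (𝕜 := ℂ)
  have hη0 : η ≠ 0 := left_ne_zero_of_mul (hη ▸ one_ne_zero)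
  filter_upwards [h4.eventually (eventually_exists_sin_eq (a / (b * η)) (h1.and (h2.and h3))),
    eventually_gt_atTop 0] with m hm hm0
  obtain ⟨φ, ⟨hφV, hφ0, hφπ⟩, hφ⟩ := hm
  have hm1 : (m : ℂ) + 1 ≠ 0 := Nat.cast_add_one_ne_zero m
  refine ⟨_, hφV, mem_spectrum_blockToeplitz hm0 hη ?_ ?_ ?_⟩
  · field_simp
  · rw [Ne, Complex.sin_eq_zero_iff]
    rintro ⟨n, hn⟩
    have hn0 : n ≠ 0 := by
      rintro rfl
      rw [Int.cast_zero, zero_mul] at hn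
      exact mul_ne_zero (inv_ne_zero hm1) hφ0 hn
    rw [hn, norm_mul, Complex.norm_intCast, Complex.norm_real, Real.norm_of_nonneg Real.pi_pos.le]
      at hφπ
    have : (1 : ℝ) ≤ |(n : ℝ)| := by exact_mod_cast Int.one_le_abs hn0
    nlinarith [Real.pi_pos]
  · rw [hφ]
    field_simp

lemma tendsto_spectralRadius_blockToeplitz {a b : ℂ} (hb : b ≠ 0) :
    Tendsto (fun m => spectralRadius ℂ (blockToeplitz a b m)) atTop
      (𝓝 (ENNReal.ofReal (max ‖a + b‖ ‖a - b‖))) := by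
  have hlow : ∀ η : ℂ, η * η = 1 → ∀ c : ℝ≥0∞, c < ‖a + η * b‖ₑ →
      ∀ᶠ m in atTop, c < spectralRadius ℂ (blockToeplitz a b m) := by
    intro η hη c hc
    have hV : {μ : ℂ | c < ‖μ‖ₑ} ∈ 𝓝 (a + η * b) :=
      continuous_enorm.continuousAt.eventually_const_lt hc
    filter_upwards [eventually_exists_mem_spectrum hb hη hV] with m hm
    obtain ⟨μ, hμ, hs⟩ := hm
    exact hμ.trans_le (le_iSup₂ (f := fun k _ => (‖k‖₊ : ℝ≥0∞)) μ hs)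
  refine tendsto_order.2 ⟨fun c hc => ?_, fun c hc => .of_forall fun m =>
    (spectralRadius_blockToeplitz_le (le_max_left _ _) (le_max_right _ _) m).trans_lt hc⟩
  rcases max_choice ‖a + b‖ ‖a - b‖ with h | h <;> rw [h, ofReal_norm] at hc
  · exact hlow 1 (by norm_num) c (by simpa using hc)
  · exact hlow (-1) (by norm_num) c (by simpa [sub_eq_add_neg] using hc)

/-! ### Classical solutions on an interval -/

lemma SolvesHelmholtz.mono {k σ a b a' b' : ℝ} {u : ℝ → ℂ} (h : SolvesHelmholtz k σ a b u)
    (ha : a ≤ a') (hb : b' ≤ b) : SolvesHelmholtz k σ a' b' u :=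
  ⟨h.1.mono (Icc_subset_Icc ha hb), fun x hx => h.2 x (Ioo_subset_Ioo ha hb hx)⟩

lemma SolvesHelmholtz.differentiableOn {k σ a b : ℝ} {u : ℝ → ℂ} (h : SolvesHelmholtz k σ a b u) :
    DifferentiableOn ℝ u (Icc a b) :=
  h.1.differentiableOn (by norm_num)

/-- The differential equation holds up to the end points, with one-sided derivatives. -/
lemma SolvesHelmholtz.hasDerivWithinAt {k σ a b : ℝ} (hab : a < b) {u : ℝ → ℂ}
    (h : SolvesHelmholtz k σ a b u) {x : ℝ} (hx : x ∈ Icc a b) :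
    HasDerivWithinAt (derivWithin u (Icc a b)) (coeff k σ * u x) (Icc a b) x := by
  have hU := uniqueDiffOn_Icc hab
  have h1 : ContDiffOn ℝ 1 (derivWithin u (Icc a b)) (Icc a b) := h.1.derivWithin hU (by norm_num)
  have h2 : ContinuousOn (derivWithin (derivWithin u (Icc a b)) (Icc a b)) (Icc a b) :=
    h1.continuousOn_derivWithin hU le_rfl
  have h3 : EqOn (derivWithin (derivWithin u (Icc a b)) (Icc a b)) (fun y => coeff k σ * u y)
      (Ioo a b) := fun y hy => by
    have hn := Icc_mem_nhds hy.1 hy.2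
    have he : derivWithin u (Icc a b) =ᶠ[𝓝 y] deriv u := by
      filter_upwards [Ioo_mem_nhds hy.1 hy.2] with z hz
      exact derivWithin_of_mem_nhds (Icc_mem_nhds hz.1 hz.2)
    rw [derivWithin_of_mem_nhds hn, he.deriv_eq]
    linear_combination -(h.2 y hy)
  have h4 := h3.of_subset_closure h2 (continuousOn_const.mul h.1.continuousOn) Ioo_subset_Icc_self
    (closure_Ioo hab.ne).ge hx
  have h5 := (h1.differentiableOn one_ne_zero x hx).hasDerivWithinAt
  rwa [h4] at h5

lemma SolvesHelmholtz.exists_deriv_add_mul_eq {k σ a b : ℝ} (hab : a < b) {u : ℝ → ℂ}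
    (h : SolvesHelmholtz k σ a b u) {s : ℂ} (hs : s ^ 2 = coeff k σ) (c : ℝ) :
    ∃ C : ℂ, ∀ x ∈ Icc a b,
      derivWithin u (Icc a b) x + s * u x = C * Complex.exp (s * (x - c : ℝ)) := by
  have hd : ∀ x ∈ Icc a b, HasDerivWithinAt (fun y : ℝ => (derivWithin u (Icc a b) y + s * u y) *
      Complex.exp (-(s * (y - c : ℝ)))) 0 (Icc a b) x := fun x hx => by
    have he := ((hasDerivAt_exp_neg_mul s (x - c)).comp_sub_const x c).hasDerivWithinAt (s := Icc a b)
    refine (((h.hasDerivWithinAt hab hx).add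
      ((h.differentiableOn x hx).hasDerivWithinAt.const_mul s)).mul he).congr_deriv ?_
    rw [← hs]
    simp only [Pi.add_apply]
    ring
  have hc := constant_of_derivWithin_zero (fun x hx => (hd x hx).differentiableWithinAt)
    fun x hx => (hd x (Ico_subset_Icc_self hx)).derivWithin
      (uniqueDiffOn_Icc hab x (Ico_subset_Icc_self hx))
  refine ⟨(derivWithin u (Icc a b) a + s * u a) * Complex.exp (-(s * (a - c : ℝ))),
    fun x hx => ?_⟩
  rw [← hc x hx, mul_assoc, ← Complex.exp_add, neg_add_cancel, Complex.exp_zero, mul_one]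

/-- A linear combination of the two exponential solutions centred at `c`. -/
noncomputable def expComb (ζ : ℂ) (c : ℝ) (c₁ c₂ : ℂ) (x : ℝ) : ℂ :=
  c₁ * Complex.exp (ζ * (x - c : ℝ)) + c₂ * Complex.exp (-(ζ * (x - c : ℝ)))

lemma hasDerivAt_expComb (ζ : ℂ) (c : ℝ) (c₁ c₂ : ℂ) (x : ℝ) :
    HasDerivAt (expComb ζ c c₁ c₂) (expComb ζ c (ζ * c₁) (-(ζ * c₂)) x) x := by
  refine ((((hasDerivAt_exp_mul ζ (x - c)).comp_sub_const x c).const_mul c₁).add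
    (((hasDerivAt_exp_neg_mul ζ (x - c)).comp_sub_const x c).const_mul c₂)).congr_deriv ?_
  simp only [expComb]; ring

lemma deriv_expComb (ζ : ℂ) (c : ℝ) (c₁ c₂ : ℂ) :
    deriv (expComb ζ c c₁ c₂) = expComb ζ c (ζ * c₁) (-(ζ * c₂)) :=
  funext fun x => (hasDerivAt_expComb ζ c c₁ c₂ x).deriv

lemma contDiff_expComb (ζ : ℂ) (c : ℝ) (c₁ c₂ : ℂ) {n : WithTop ℕ∞} :
    ContDiff ℝ n (expComb ζ c c₁ c₂) := by
  have h : ContDiff ℝ n fun x : ℝ => ζ * ((x - c : ℝ) : ℂ) :=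
    contDiff_const.mul (Complex.ofRealCLM.contDiff.comp (contDiff_id.sub contDiff_const))
  exact (contDiff_const.mul h.cexp).add (contDiff_const.mul h.neg.cexp)

lemma solvesHelmholtz_expComb (k σ a b c : ℝ) (c₁ c₂ : ℂ) :
    SolvesHelmholtz k σ a b (expComb (zeta k σ) c c₁ c₂) := by
  refine ⟨(contDiff_expComb _ _ _ _).contDiffOn, fun x _ => ?_⟩
  rw [deriv_expComb, deriv_expComb, ← zeta_sq]
  simp only [expComb]; ring

lemma SolvesHelmholtz.exists_eq_expComb {k σ a b : ℝ} (hk : 0 < k) (hσ : 0 < σ) (hab : a < b)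
    {u : ℝ → ℂ} (h : SolvesHelmholtz k σ a b u) (c : ℝ) :
    ∃ c₁ c₂ : ℂ, EqOn u (expComb (zeta k σ) c c₁ c₂) (Icc a b) := by
  have hζ := zeta_ne_zero hk hσ
  obtain ⟨C, hC⟩ := h.exists_deriv_add_mul_eq hab (zeta_sq k σ) c
  obtain ⟨C', hC'⟩ := h.exists_deriv_add_mul_eq hab (s := -zeta k σ)
    (by rw [neg_sq, zeta_sq]) c
  refine ⟨C / (2 * zeta k σ), -C' / (2 * zeta k σ), fun x hx => ?_⟩
  have h1 := hC x hx
  have h2 := hC' x hx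
  rw [neg_mul, neg_mul] at h2
  simp only [expComb]
  field_simp
  linear_combination h1 - h2

lemma robinRight_congr {α : ℂ} {a b : ℝ} {u w : ℝ → ℂ} (h : EqOn u w (Icc a b)) {x : ℝ}
    (hx : x ∈ Icc a b) : robinRight α a b u x = robinRight α a b w x := by
  rw [robinRight, robinRight, derivWithin_congr h (h hx), h hx]

lemma robinLeft_congr {α : ℂ} {a b : ℝ} {u w : ℝ → ℂ} (h : EqOn u w (Icc a b)) {x : ℝ}
    (hx : x ∈ Icc a b) : robinLeft α a b u x = robinLeft α a b w x := by
  rw [robinLeft, robinLeft, derivWithin_congr h (h hx), h hx]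

lemma robinRight_expComb (α ζ : ℂ) {a b : ℝ} (hab : a < b) (c : ℝ) (c₁ c₂ : ℂ) {x : ℝ}
    (hx : x ∈ Icc a b) : robinRight α a b (expComb ζ c c₁ c₂) x =
      expComb ζ c ((ζ + α) * c₁) (-((ζ - α) * c₂)) x := by
  rw [robinRight, (hasDerivAt_expComb ζ c c₁ c₂ x).hasDerivWithinAt.derivWithin
    (uniqueDiffOn_Icc hab x hx)]
  simp only [expComb]; ring

lemma robinLeft_expComb (α ζ : ℂ) {a b : ℝ} (hab : a < b) (c : ℝ) (c₁ c₂ : ℂ) {x : ℝ}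
    (hx : x ∈ Icc a b) : robinLeft α a b (expComb ζ c c₁ c₂) x =
      expComb ζ c (-((ζ - α) * c₁)) ((ζ + α) * c₂) x := by
  rw [robinLeft, (hasDerivAt_expComb ζ c c₁ c₂ x).hasDerivWithinAt.derivWithin
    (uniqueDiffOn_Icc hab x hx)]
  simp only [expComb]; ring

/-! ### One subdomain -/

lemma entries_mul_exp {α : ℂ} {k σ δ L : ℝ} (hD : denom α k σ δ L ≠ 0) :
    let P := zeta k σ + α
    let Q := zeta k σ - α
    let y := Complex.exp (zeta k σ * (δ + L / 2 : ℝ))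
    let y' := Complex.exp (-(zeta k σ * (δ + L / 2 : ℝ)))
    let w := Complex.exp (zeta k σ * (δ - L / 2 : ℝ))
    let w' := Complex.exp (-(zeta k σ * (δ - L / 2 : ℝ)))
    P * w = entryA α k σ δ L * (P * y) - entryB α k σ δ L * (Q * y') ∧
      Q * w' = entryA α k σ δ L * (Q * y') - entryB α k σ δ L * (P * y) := by
  intro P Q y y' w w'
  set p := zeta k σ * ((δ + L / 2 : ℝ) : ℂ) with hp
  set m := zeta k σ * ((δ - L / 2 : ℝ) : ℂ) with hm
  have h1 : 2 * zeta k σ * δ = p + m := by rw [hp, hm]; push_cast; ring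
  have h2 : zeta k σ * L = p + -m := by rw [hp, hm]; push_cast; ring
  have h3 : -(p + -m) = -p + m := by ring
  have h4 : zeta k σ * (2 * δ + L) = p + p := by rw [hp]; push_cast; ring
  have hD' : denom α k σ δ L = P ^ 2 * (y * y) - Q ^ 2 * (y' * y') := by
    rw [denom, h4, neg_add, Complex.exp_add, Complex.exp_add]
  have hA : entryA α k σ δ L * denom α k σ δ L = P ^ 2 * (y * w) - Q ^ 2 * (y' * w') := by
    rw [entryA, div_mul_cancel₀ _ hD, h1, neg_add, Complex.exp_add, Complex.exp_add]
  have hB : entryB α k σ δ L * denom α k σ δ L = -(P * Q * (y * w' - y' * w)) := by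
    rw [entryB, div_mul_cancel₀ _ hD, h2, h3, Complex.exp_add, Complex.exp_add]
    ring
  constructor <;> refine mul_right_cancel₀ hD ?_
  · linear_combination P * w * hD' - P * y * hA + Q * y' * hB
  · linear_combination Q * w' * hD' - Q * y' * hA + P * y * hB

/-- The traces transmitted by a subdomain are the combinations, with coefficients `a` and `b`, of
the traces received by it. -/
lemma SolvesHelmholtz.traces {α : ℂ} {k σ δ L A B : ℝ} (hk : 0 < k) (hσ : 0 < σ) (hδ : 0 < δ)
    (hL : 0 < L) (hD : denom α k σ δ L ≠ 0) (hB : B = A + (L + 2 * δ)) {f : ℝ → ℂ}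
    (h : SolvesHelmholtz k σ A B f) :
    robinRight α A B f (A + 2 * δ) =
        entryA α k σ δ L * robinRight α A B f B + entryB α k σ δ L * robinLeft α A B f A ∧
      robinLeft α A B f (A + L) =
        entryB α k σ δ L * robinRight α A B f B + entryA α k σ δ L * robinLeft α A B f A := by
  have hAB : A < B := by linarith
  obtain ⟨c₁, c₂, hf⟩ := h.exists_eq_expComb hk hσ hAB (A + (δ + L / 2))
  have m1 : A ∈ Icc A B := ⟨le_rfl, hAB.le⟩
  have m2 : B ∈ Icc A B := ⟨hAB.le, le_rfl⟩
  have m3 : A + 2 * δ ∈ Icc A B := ⟨by linarith, by linarith⟩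
  have m4 : A + L ∈ Icc A B := ⟨by linarith, by linarith⟩
  rw [robinRight_congr hf m3, robinRight_congr hf m2, robinLeft_congr hf m1,
    robinLeft_congr hf m4, robinRight_expComb _ _ hAB _ _ _ m3, robinRight_expComb _ _ hAB _ _ _ m2,
    robinLeft_expComb _ _ hAB _ _ _ m1, robinLeft_expComb _ _ hAB _ _ _ m4]
  have d1 : A - (A + (δ + L / 2)) = -(δ + L / 2) := by ring
  have d2 : B - (A + (δ + L / 2)) = δ + L / 2 := by rw [hB]; ring
  have d3 : A + 2 * δ - (A + (δ + L / 2)) = δ - L / 2 := by ring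
  have d4 : A + L - (A + (δ + L / 2)) = -(δ - L / 2) := by ring
  obtain ⟨e1, e2⟩ := entries_mul_exp hD
  simp only [expComb, d1, d2, d3, d4, Complex.ofReal_neg, mul_neg, neg_neg]
  constructor
  · linear_combination c₁ * e1 - c₂ * e2
  · linear_combination c₂ * e1 - c₁ * e2

/-- Solvability of the subdomain problems. -/
lemma exists_solvesHelmholtz {α : ℂ} {k σ δ L A B : ℝ} (hδ : 0 < δ) (hL : 0 < L)
    (hD : denom α k σ δ L ≠ 0) (hB : B = A + (L + 2 * δ)) (g h : ℂ) :
    ∃ f : ℝ → ℂ, SolvesHelmholtz k σ A B f ∧ robinLeft α A B f A = g ∧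
      robinRight α A B f B = h := by
  have hAB : A < B := by linarith
  set p := zeta k σ * ((δ + L / 2 : ℝ) : ℂ) with hp
  have h4 : zeta k σ * (2 * δ + L) = p + p := by rw [hp]; push_cast; ring
  have hyy : Complex.exp p * Complex.exp (-p) = 1 := by
    rw [← Complex.exp_add, add_neg_cancel, Complex.exp_zero]
  have hD' : denom α k σ δ L = (zeta k σ + α) ^ 2 * (Complex.exp p * Complex.exp p) -
      (zeta k σ - α) ^ 2 * (Complex.exp (-p) * Complex.exp (-p)) := by
    rw [denom, h4, neg_add, Complex.exp_add, Complex.exp_add]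
  refine ⟨expComb (zeta k σ) (A + (δ + L / 2))
    (((zeta k σ + α) * Complex.exp p * h + (zeta k σ - α) * Complex.exp (-p) * g) /
      denom α k σ δ L)
    (((zeta k σ + α) * Complex.exp p * g + (zeta k σ - α) * Complex.exp (-p) * h) /
      denom α k σ δ L), solvesHelmholtz_expComb _ _ _ _ _ _ _, ?_, ?_⟩
  · rw [robinLeft_expComb _ _ hAB _ _ _ ⟨le_rfl, hAB.le⟩]
    have d1 : A - (A + (δ + L / 2)) = -(δ + L / 2) := by ring
    simp only [expComb, d1, Complex.ofReal_neg, mul_neg, neg_neg, ← hp]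
    refine mul_right_cancel₀ hD ?_
    field_simp
    linear_combination -g * hD'
  · rw [robinRight_expComb _ _ hAB _ _ _ ⟨hAB.le, le_rfl⟩]
    have d2 : B - (A + (δ + L / 2)) = δ + L / 2 := by rw [hB]; ring
    simp only [expComb, d2, ← hp]
    refine mul_right_cancel₀ hD ?_
    field_simp
    linear_combination -h * hD'

/-- Initial guesses with arbitrary Robin traces: `e^{α x}` and `e^{-α x}` are each invisible to one
of the two Robin operators. -/
lemma exists_contDiff_robin_eq {α : ℂ} (hα : α ≠ 0) {A B s t : ℝ} (hAB : A < B)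
    (hs : s ∈ Icc A B) (ht : t ∈ Icc A B) (g h : ℂ) :
    ∃ f : ℝ → ℂ, ContDiff ℝ 1 f ∧ robinRight α A B f s = g ∧ robinLeft α A B f t = h := by
  refine ⟨expComb α 0 (g * Complex.exp (-(α * s)) / (2 * α)) (h * Complex.exp (α * t) / (2 * α)),
    contDiff_expComb _ _ _ _, ?_, ?_⟩
  · rw [robinRight_expComb _ _ hAB _ _ _ hs]
    simp only [expComb, sub_zero, sub_self, zero_mul, neg_zero, add_zero]
    rw [← two_mul, mul_div_cancel₀ _ (mul_ne_zero two_ne_zero hα), mul_assoc, ← Complex.exp_add,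
      neg_add_cancel, Complex.exp_zero, mul_one]
  · rw [robinLeft_expComb _ _ hAB _ _ _ ht]
    simp only [expComb, sub_zero, sub_self, zero_mul, neg_zero, zero_add]
    rw [← two_mul, mul_div_cancel₀ _ (mul_ne_zero two_ne_zero hα), mul_assoc, ← Complex.exp_add,
      add_neg_cancel, Complex.exp_zero, mul_one]

/-! ### The interface iteration -/

lemma robinRight_sub {α : ℂ} {a b : ℝ} {u w : ℝ → ℂ}
    (hu : DifferentiableOn ℝ u (Icc a b)) (hw : DifferentiableOn ℝ w (Icc a b)) {x : ℝ}
    (hx : x ∈ Icc a b) : robinRight α a b (fun y => u y - w y) x =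
      robinRight α a b u x - robinRight α a b w x := by
  rw [robinRight, derivWithin_fun_sub (hu x hx) (hw x hx), robinRight, robinRight]
  ring

lemma robinLeft_sub {α : ℂ} {a b : ℝ} {u w : ℝ → ℂ}
    (hu : DifferentiableOn ℝ u (Icc a b)) (hw : DifferentiableOn ℝ w (Icc a b)) {x : ℝ}
    (hx : x ∈ Icc a b) : robinLeft α a b (fun y => u y - w y) x =
      robinLeft α a b u x - robinLeft α a b w x := by
  rw [robinLeft, derivWithin_fun_sub (hu x hx) (hw x hx), robinLeft, robinLeft]
  ring

lemma leftEnd_succ (L a₁ : ℝ) (j : ℕ) : leftEnd L a₁ (j + 1) = leftEnd L a₁ j + L := by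
  simp only [leftEnd]; push_cast; ring

lemma rightEnd_eq (δ L a₁ : ℝ) (j : ℕ) :
    rightEnd δ L a₁ j = leftEnd L a₁ (j + 1) + 2 * δ := by
  rw [leftEnd_succ, rightEnd]; ring

lemma leftEnd_mono {L : ℝ} (hL : 0 < L) (a₁ : ℝ) : Monotone (leftEnd L a₁) :=
  monotone_nat_of_le_succ fun j => by rw [leftEnd_succ]; linarith

lemma rightEnd_mono {L : ℝ} (hL : 0 < L) (δ a₁ : ℝ) : Monotone (rightEnd δ L a₁) := fun _ _ h => by
  simpa only [rightEnd, add_le_add_iff_right] using leftEnd_mono hL a₁ h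

lemma leftEnd_lt_rightEnd {δ L : ℝ} (hδ : 0 < δ) (hL : 0 < L) (a₁ : ℝ) (j : ℕ) :
    leftEnd L a₁ j < rightEnd δ L a₁ j := by
  rw [rightEnd]; linarith

lemma iterationMatrix_isIterationMatrix {α : ℂ} {k σ δ L : ℝ} (hk : 0 < k) (hσ : 0 < σ)
    (hδ : 0 < δ) (hL : 0 < L) (hD : denom α k σ δ L ≠ 0) {N : ℕ} (hN : 1 ≤ N) :
    IsIterationMatrix α k σ δ L N (iterationMatrix α k σ δ L N) := by
  intro a₁ g₁ g₂ u v hu hv n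
  have hlt := leftEnd_lt_rightEnd hδ hL a₁
  -- The restrictions of `u` and the iterates are differentiable up to the boundary.
  have hsub : ∀ {j}, 1 ≤ j → j ≤ N → Icc (leftEnd L a₁ j) (rightEnd δ L a₁ j) ⊆
      Icc (leftEnd L a₁ 1) (rightEnd δ L a₁ N) := fun h1 h2 =>
    Icc_subset_Icc (leftEnd_mono hL a₁ h1) (rightEnd_mono hL δ a₁ h2)
  have hud := hu.eqn.differentiableOn
  have hus : ∀ {j}, 1 ≤ j → j ≤ N → SolvesHelmholtz k σ (leftEnd L a₁ j) (rightEnd δ L a₁ j) u :=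
    fun h1 h2 => hu.eqn.mono (leftEnd_mono hL a₁ h1) (rightEnd_mono hL δ a₁ h2)
  have hvd : ∀ n {j}, 1 ≤ j → j ≤ N →
      DifferentiableOn ℝ (v n j) (Icc (leftEnd L a₁ j) (rightEnd δ L a₁ j)) := by
    intro n j h1 h2
    rcases n with _ | n
    · exact (hv.init j h1 h2).differentiableOn one_ne_zero
    · exact (hv.eqn n j h1 h2).differentiableOn
  have hur : ∀ {j}, 1 ≤ j → j ≤ N → ∀ {x}, x ∈ Icc (leftEnd L a₁ j) (rightEnd δ L a₁ j) →
      subRight α δ L a₁ j u x = robinRight α (leftEnd L a₁ 1) (rightEnd δ L a₁ N) u x :=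
    fun h1 h2 x hx => by
      rw [subRight, robinRight, robinRight, derivWithin_subset (hsub h1 h2)
        (uniqueDiffOn_Icc (hlt _) x hx) (hud x (hsub h1 h2 hx))]
  have hul : ∀ {j}, 1 ≤ j → j ≤ N → ∀ {x}, x ∈ Icc (leftEnd L a₁ j) (rightEnd δ L a₁ j) →
      subLeft α δ L a₁ j u x = robinLeft α (leftEnd L a₁ 1) (rightEnd δ L a₁ N) u x :=
    fun h1 h2 x hx => by
      rw [subLeft, robinLeft, robinLeft, derivWithin_subset (hsub h1 h2)
        (uniqueDiffOn_Icc (hlt _) x hx) (hud x (hsub h1 h2 hx))]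
  have her : ∀ n {j}, 1 ≤ j → j ≤ N → ∀ {x}, x ∈ Icc (leftEnd L a₁ j) (rightEnd δ L a₁ j) →
      subRight α δ L a₁ j (fun y => u y - v n j y) x =
        subRight α δ L a₁ j u x - subRight α δ L a₁ j (v n j) x := fun n j h1 h2 x hx =>
    robinRight_sub (hus h1 h2).differentiableOn (hvd n h1 h2) hx
  have hel : ∀ n {j}, 1 ≤ j → j ≤ N → ∀ {x}, x ∈ Icc (leftEnd L a₁ j) (rightEnd δ L a₁ j) →
      subLeft α δ L a₁ j (fun y => u y - v n j y) x =
        subLeft α δ L a₁ j u x - subLeft α δ L a₁ j (v n j) x := fun n j h1 h2 x hx =>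
    robinLeft_sub (hus h1 h2).differentiableOn (hvd n h1 h2) hx
  -- The four points of a subdomain at which Robin traces are taken.
  have m1 : ∀ j, leftEnd L a₁ j ∈ Icc (leftEnd L a₁ j) (rightEnd δ L a₁ j) := fun j =>
    ⟨le_rfl, (hlt j).le⟩
  have m2 : ∀ j, rightEnd δ L a₁ j ∈ Icc (leftEnd L a₁ j) (rightEnd δ L a₁ j) := fun j =>
    ⟨(hlt j).le, le_rfl⟩
  have m3 : ∀ j, leftEnd L a₁ (j + 1) ∈ Icc (leftEnd L a₁ j) (rightEnd δ L a₁ j) := fun j => by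
    rw [rightEnd, leftEnd_succ]; constructor <;> linarith
  have m4 : ∀ j, rightEnd δ L a₁ j ∈ Icc (leftEnd L a₁ (j + 1)) (rightEnd δ L a₁ (j + 1)) :=
    fun j => by simp only [mem_Icc, rightEnd, leftEnd_succ]; constructor <;> linarith
  -- The traces received by the subdomain `i + 1` in step `n + 1`.
  set p : ℕ → ℂ := fun i => subRight α δ L a₁ (i + 1) (fun y => u y - v (n + 1) (i + 1) y)
    (rightEnd δ L a₁ (i + 1)) with hp
  set q : ℕ → ℂ := fun i => subLeft α δ L a₁ (i + 1) (fun y => u y - v (n + 1) (i + 1) y)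
    (leftEnd L a₁ (i + 1)) with hq
  have hpN : p (N - 1) = 0 := by
    simp only [hp, Nat.sub_add_cancel hN]
    rw [her _ hN le_rfl (m2 N), hv.bdryRight, hur hN le_rfl (m2 N), hu.right, sub_self]
  have hq0 : q 0 = 0 := by
    simp only [hq, zero_add]
    rw [hel _ le_rfl hN (m1 1), hv.bdryLeft, hul le_rfl hN (m1 1), hu.left, sub_self]
  have hold : interfaceData α δ L a₁ N u (v n) = pack (N - 1) p q := by
    ext ⟨⟨i, hi⟩, c⟩
    have h1 : i + 1 + 1 ≤ N := by omega
    fin_cases c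
    · change subRight α δ L a₁ (i + 1 + 1) _ (rightEnd δ L a₁ (i + 1)) =
        subRight α δ L a₁ (i + 1) _ _
      rw [her _ (by omega) h1 (m4 _), her _ (by omega) (by omega) (m2 _),
        hv.transRight n (i + 1) (by omega) h1, hur (by omega) h1 (m4 _),
        hur (by omega) (by omega) (m2 _)]
    · change subLeft α δ L a₁ (i + 1) _ (leftEnd L a₁ (i + 1 + 1)) =
        subLeft α δ L a₁ (i + 1 + 1) _ _
      rw [hel _ (by omega) h1 (m1 _), hel _ (by omega) (by omega) (m3 _),
        hv.transLeft n (i + 1) (by omega) h1, hul (by omega) h1 (m1 _),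
        hul (by omega) (by omega) (m3 _)]
  rw [iterationMatrix, hold, blockToeplitz_mulVec_pack _ _ hpN hq0]
  -- Each subdomain turns the traces it receives into those it transmits.
  have htr : ∀ {j f}, SolvesHelmholtz k σ (leftEnd L a₁ j) (rightEnd δ L a₁ j) f → _ :=
    fun {j _} hf => hf.traces (α := α) (B := rightEnd δ L a₁ j) hk hσ hδ hL hD rfl
  ext ⟨⟨i, hi⟩, c⟩
  have h1 : i + 1 + 1 ≤ N := by omega
  fin_cases c
  · change subRight α δ L a₁ (i + 1 + 1) _ (rightEnd δ L a₁ (i + 1)) =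
      _ * p (i + 1) + _ * q (i + 1)
    simp only [hp, hq]
    rw [her _ (by omega) h1 (m4 _), her _ (by omega) h1 (m2 _), hel _ (by omega) h1 (m1 _),
      rightEnd_eq δ L a₁ (i + 1)]
    have t1 := (htr (hus (j := i + 1 + 1) (by omega) h1)).1
    have t2 := (htr (hv.eqn n (i + 1 + 1) (by omega) h1)).1
    simp only [subRight, subLeft]
    rw [t1, t2]
    ring
  · change subLeft α δ L a₁ (i + 1) _ (leftEnd L a₁ (i + 1 + 1)) =
      _ * p (i + 1 - 1) + _ * q (i + 1 - 1)
    simp only [hp, hq, Nat.add_sub_cancel]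
    rw [hel _ (by omega) (by omega) (m3 _), her _ (by omega) (by omega) (m2 _),
      hel _ (by omega) (by omega) (m1 _), leftEnd_succ L a₁ (i + 1)]
    have t1 := (htr (hus (j := i + 1) (by omega) (by omega))).2
    have t2 := (htr (hv.eqn n (i + 1) (by omega) (by omega))).2
    simp only [subRight, subLeft]
    rw [t1, t2]
    ring

/-- Every vector is the interface data of initial guesses for the homogeneous problem, from which
the Schwarz iteration can be started. -/
lemma exists_isSchwarzIteration {α : ℂ} {k σ δ L : ℝ} (hα : α ≠ 0) (hδ : 0 < δ) (hL : 0 < L)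
    (hD : denom α k σ δ L ≠ 0) (a₁ : ℝ) (N : ℕ) (x : Fin (N - 1) × Fin 2 → ℂ) :
    ∃ v, IsSchwarzIteration α k σ δ L a₁ N 0 0 v ∧
      interfaceData α δ L a₁ N (fun _ => 0) (v 0) = x := by
  obtain ⟨p, q, -, -, rfl⟩ := exists_eq_pack x
  have hlt := leftEnd_lt_rightEnd hδ hL a₁
  -- The entry `p i` is a trace on subdomain `i + 2`; for `j ≤ 1` the value `p (j - 2)` is arbitrary.
  have hinit : ∀ j, ∃ f : ℝ → ℂ, ContDiff ℝ 1 f ∧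
      robinRight α (leftEnd L a₁ j) (rightEnd δ L a₁ j) f (leftEnd L a₁ j + 2 * δ) = p (j - 2) ∧
      robinLeft α (leftEnd L a₁ j) (rightEnd δ L a₁ j) f (leftEnd L a₁ j + L) = q j := fun j =>
    exists_contDiff_robin_eq hα (hlt j) (by rw [rightEnd]; constructor <;> linarith)
      (by rw [rightEnd]; constructor <;> linarith) _ _
  choose f₀ hf₀ hf₀r hf₀l using hinit
  have hstep : ∀ (w : ℕ → ℝ → ℂ) (j : ℕ), ∃ f : ℝ → ℂ,
      SolvesHelmholtz k σ (leftEnd L a₁ j) (rightEnd δ L a₁ j) f ∧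
      subLeft α δ L a₁ j f (leftEnd L a₁ j) =
        (if j ≤ 1 then 0 else subLeft α δ L a₁ (j - 1) (w (j - 1)) (leftEnd L a₁ j)) ∧
      subRight α δ L a₁ j f (rightEnd δ L a₁ j) =
        (if N ≤ j then 0 else subRight α δ L a₁ (j + 1) (w (j + 1)) (rightEnd δ L a₁ j)) :=
    fun w j => exists_solvesHelmholtz hδ hL hD rfl _ _
  choose F hF hFl hFr using hstep
  let v : ℕ → ℕ → ℝ → ℂ := fun n => Nat.rec (fun j => -f₀ j) (fun _ w => F w) n
  refine ⟨v, ⟨fun j _ _ => (hf₀ j).neg.contDiffOn, fun n j _ _ => hF (v n) j, fun n j h1 h2 => ?_,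
    fun n j h1 h2 => ?_, fun n => ?_, fun n => ?_⟩, ?_⟩
  · refine (hFl (v n) (j + 1)).trans ?_
    rw [if_neg (by omega), Nat.add_sub_cancel]
  · refine (hFr (v n) j).trans ?_
    rw [if_neg (by omega)]
  · refine (hFl (v n) 1).trans ?_
    rw [if_pos le_rfl]
  · refine (hFr (v n) N).trans ?_
    rw [if_pos le_rfl]
  · have h0 : ∀ j, (fun y : ℝ => (0 : ℂ) - v 0 j y) = f₀ j := fun j => by
      funext y
      change 0 - -f₀ j y = f₀ j y
      ring
    ext ⟨⟨i, hi⟩, c⟩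
    fin_cases c
    · change subRight α δ L a₁ (i + 1 + 1) (fun y => 0 - v 0 (i + 1 + 1) y)
        (rightEnd δ L a₁ (i + 1)) = p i
      rw [h0, rightEnd_eq]
      exact hf₀r (i + 1 + 1)
    · change subLeft α δ L a₁ (i + 1) (fun y => 0 - v 0 (i + 1) y)
        (leftEnd L a₁ (i + 1 + 1)) = q (i + 1)
      rw [h0, leftEnd_succ]
      exact hf₀l (i + 1)

lemma isGlobalSolution_zero (α : ℂ) (k σ δ L a₁ : ℝ) (N : ℕ) :
    IsGlobalSolution α k σ δ L a₁ N 0 0 (fun _ => 0) := by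
  refine ⟨⟨contDiffOn_const, fun x _ => ?_⟩, ?_, ?_⟩
  · simp
  · simp [robinLeft]
  · simp [robinRight]

lemma isIterationMatrix_iff {α : ℂ} {k σ δ L : ℝ} (hα : α ≠ 0) (hk : 0 < k) (hσ : 0 < σ)
    (hδ : 0 < δ) (hL : 0 < L) (hD : denom α k σ δ L ≠ 0) {N : ℕ} (hN : 1 ≤ N)
    (M : Matrix (Fin (N - 1) × Fin 2) (Fin (N - 1) × Fin 2) ℂ) :
    IsIterationMatrix α k σ δ L N M ↔ M = iterationMatrix α k σ δ L N := by
  have hT := iterationMatrix_isIterationMatrix hk hσ hδ hL hD hN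
  refine ⟨fun hM => Matrix.mulVec_injective (funext fun x => ?_), fun h => h ▸ hT⟩
  obtain ⟨v, hv, rfl⟩ := exists_isSchwarzIteration (k := k) (σ := σ) hα hδ hL hD 0 N x
  have hu := isGlobalSolution_zero α k σ δ L 0 N
  exact (hM 0 0 0 _ v hu hv 0).symm.trans (hT 0 0 0 _ v hu hv 0)

lemma norm_interfaceData_le {α : ℂ} {k σ δ L r : ℝ} {N : ℕ}
    (hT : IsIterationMatrix α k σ δ L N (iterationMatrix α k σ δ L N))
    (h₁ : ‖entryA α k σ δ L + entryB α k σ δ L‖ ≤ r)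
    (h₂ : ‖entryA α k σ δ L - entryB α k σ δ L‖ ≤ r) {a₁ : ℝ} {g₁ g₂ : ℂ} {u : ℝ → ℂ}
    {v : ℕ → ℕ → ℝ → ℂ} (hu : IsGlobalSolution α k σ δ L a₁ N g₁ g₂ u)
    (hv : IsSchwarzIteration α k σ δ L a₁ N g₁ g₂ v) (n : ℕ) :
    ‖WithLp.toLp 2 (interfaceData α δ L a₁ N u (v n))‖ ≤
      r ^ n * ‖WithLp.toLp 2 (interfaceData α δ L a₁ N u (v 0))‖ := by
  have hr : 0 ≤ r := (norm_nonneg _).trans h₁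
  induction n with
  | zero => simp
  | succ n ih =>
    rw [hT a₁ g₁ g₂ u v hu hv n, pow_succ', mul_assoc]
    exact (norm_blockToeplitz_mulVec_le h₁ h₂ _).trans (by gcongr)

end Schwarz1D

theorem theorem3p4 (k σ δ L : ℝ) (hk : 0 < k) (hσ : 0 < σ) (hδ : 0 < δ) (hL : 0 < L)
    (α : ℂ) (hα : α = Complex.I * k) :
    (∀ N : ℕ, 2 ≤ N → ∀ M : Matrix (Fin (N - 1) × Fin 2) (Fin (N - 1) × Fin 2) ℂ,
      Schwarz1D.IsIterationMatrix α k σ δ L N M ↔ M = Schwarz1D.iterationMatrix α k σ δ L N) ∧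
    (∃ R : ℝ≥0∞, Tendsto (fun N : ℕ => spectralRadius ℂ (Schwarz1D.iterationMatrix α k σ δ L N))
        atTop (𝓝 R) ∧ R < 1) ∧
    (∃ (q C : ℝ) (N₀ : ℕ), 0 ≤ q ∧ q < 1 ∧ ∀ N : ℕ, N₀ ≤ N → 2 ≤ N →
      ∀ (a₁ : ℝ) (g₁ g₂ : ℂ) (u : ℝ → ℂ) (v : ℕ → ℕ → ℝ → ℂ),
        Schwarz1D.IsGlobalSolution α k σ δ L a₁ N g₁ g₂ u →
        Schwarz1D.IsSchwarzIteration α k σ δ L a₁ N g₁ g₂ v →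
        ∀ n : ℕ,
          ‖WithLp.toLp 2 (Schwarz1D.interfaceData α δ L a₁ N u (v n))‖ ≤
            C * q ^ n * ‖WithLp.toLp 2 (Schwarz1D.interfaceData α δ L a₁ N u (v 0))‖) := by
  subst hα
  have hα0 : Complex.I * (k : ℂ) ≠ 0 := by simp [hk.ne']
  have hD := Schwarz1D.denom_ne_zero hk hσ hδ hL
  have h1 := Schwarz1D.norm_entryA_add_mul_entryB_lt_one hk hσ hδ hL (.inl rfl)
  have h2 := Schwarz1D.norm_entryA_add_mul_entryB_lt_one hk hσ hδ hL (.inr rfl)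
  rw [one_mul] at h1
  rw [neg_one_mul, ← sub_eq_add_neg] at h2
  refine ⟨fun N hN M => Schwarz1D.isIterationMatrix_iff hα0 hk hσ hδ hL hD (by omega) M,
    ⟨_, (Schwarz1D.tendsto_spectralRadius_blockToeplitz
      (Schwarz1D.entryB_ne_zero hk hσ hδ hL)).comp (tendsto_sub_atTop_nat 1),
      ENNReal.ofReal_lt_one.2 (max_lt h1 h2)⟩,
    ⟨_, 1, 0, (norm_nonneg _).trans (le_max_left _ _), max_lt h1 h2,
      fun N _ hN a₁ g₁ g₂ u v hu hv n => ?_⟩⟩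
  rw [one_mul]
  exact Schwarz1D.norm_interfaceData_le
    (Schwarz1D.iterationMatrix_isIterationMatrix hk hσ hδ hL hD (by omega))
    (le_max_left _ _) (le_max_right _ _) hu hv n
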